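/- **Conventions.** Let $K$ be an algebraically closed field of characteristic zero. Let $U$ be a finite-dimensional $K$-vector space with linear coordinates $A_s$ ($s\in\sigma$). For a homogeneous ideal $I\subseteq K[A_s]$ let $\mathcal V(I)\subseteq\mathbb P(U)$ be the set of points at which all homogeneous elements of $I$ vanish, let $S(I)$ be the ideal generated by all $\partial f/\partial A_s$ with $f\in I$, $s\in\sigma$, and let $S^{(k)}$ be the $k$-fold iterate of $S$. The multiplicity at $p\in X=\mathcal V(I)$ of the variety defined by $I$ is the integer $k\ge 1$ with $p\in\mathcal V(S^{(k-1)}(I))\setminus\mathcal V(S^{(k)}(I))$; it is written $\operatorname{Mult}_pX$. Let $p=[a]$ with $a_i\ne0$. The *leading form* of $f$ at $a/a_i$ is the nonzero homogeneous part of lowest degree of the polynomial $f(a/a_i+A)$. The *affine tangent cone* $TC_pX$ in the chart $A_i=1$ is the set of $y\in U$ with $y_i=1$ and $g(y-a/a_i)=0$ for the leading forms $g$ at $a/a_i$ of all nonzero homogeneous $f\in I$; the *projective tangent cone* $\mathbb TC_pX$ is the set of $[q]\in\mathbb P(U)$ with $g(a_iq-q_ia)=0$ for all these $g$. (If $I=\langle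 f\rangle$, it suffices to take the leading form of $f$.) **Setting.** Let $E$ be a finite set and $0\ne W\subseteq K^E$ a linear subspace. For $a\in K^E$ let $B_E(a)$ be the symmetric bilinear form $(v,w)\mapsto\sum_{e\in E}a_ev_ew_e$ on $K^E$ and $B_E(a)|_W\in\operatorname{Sym}^2W^\vee$ its restriction to $W$, where $\operatorname{Sym}^2W^\vee$ is the space of symmetric bilinear forms on $W$. Let $X_W\subseteq\mathbb P(K^E)$ be the hypersurface defined by the configuration polynomial $\Psi_W=\det(B_E|_W)$, and let $\mathfrak X\subseteq\mathbb P(\operatorname{Sym}^2W^\vee)$ be the hypersurface of degenerate forms, defined by the determinant (in a basis of $W$; both polynomials are well defined up to a nonzero constant). Let $V=\{[a]\in\mathbb P(K^E): B_E(a)|_W=0\}$, let $\pi:\mathbb P(K^E)\setminus V\to\mathbb P(\operatorname{Sym}^2W^\vee)$, $[a]\mapsto[B_E(a)|_W]$, and let $L=\mathbb P(\{B_E(a)|_W:a\in K^E\})$, a linear subspace of $\mathbb P(\operatorname{Sym}^2W^\vee)$. The intersection $L\cap\mathfrak X$ is defined by the sum of the ideal generated by the linear forms vanishing on $L$ and the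 ideal generated by the determinant. **Corollary (Intersection of Tangent Cones).** For every $x\in X_W\setminus V$, $$\operatorname{Mult}_xX_W=\operatorname{Mult}_{\pi(x)}\mathfrak X,$$ and $$\mathbb TC_{\pi(x)}(L\cap\mathfrak X)=L\cap\mathbb TC_{\pi(x)}\mathfrak X,$$ and likewise for the affine tangent cones, in every chart $A_i=1$ around $\pi(x)$, for arbitrary linear coordinates on $\operatorname{Sym}^2W^\vee$ (with $L$ replaced by the linear space $\{B_E(a)|_W\}$). If $V$ is empty, then $a\mapsto B_E(a)|_W$ is injective, so that $\pi$ embeds $\mathbb P(K^E)$ into $\mathbb P(\operatorname{Sym}^2W^\vee)$, and for every $x\in X_W$ $$\pi\big(\mathbb TC_xX_W\big)=L\cap\mathbb TC_{\pi(x)}\mathfrak X.$$ -/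

import Mathlib

namespace ConfigTC

open MvPolynomial

/-! ### Projective varieties, multiplicity and tangent cones

Throughout, `U` is a `K`-vector space with a finite basis `c : Module.Basis σ K U`. The coordinate ring
of `ℙ(U)` is `K[A_s : s ∈ σ]`, where `A_s` is the `s`-th coordinate function of `c`. A projective
variety comes with a defining homogeneous ideal of that ring. -/

section Projective

variable {K : Type*} [Field K] {U : Type*} [AddCommGroup U] [Module K U] {σ : Type*}

/-- The value of a polynomial in the coordinates of `c` at a vector. -/
noncomputable def evalAt (c : Module.Basis σ K U) (u : U) (f : MvPolynomial σ K) : K :=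
  MvPolynomial.eval (fun s => c.repr u s) f

/-- `V(I)`: the points of `ℙ(U)` at which all homogeneous elements of `I` vanish. -/
def zeroLocus (c : Module.Basis σ K U) (I : Ideal (MvPolynomial σ K)) :
    Set (Projectivization K U) :=
  {p | ∀ f ∈ I, ∀ d : ℕ, f.IsHomogeneous d → evalAt c p.rep f = 0}

/-- The first order singularity ideal `S(I)`, generated by the first partial derivatives of all
elements of `I`. -/
noncomputable def singularityIdeal (I : Ideal (MvPolynomial σ K)) : Ideal (MvPolynomial σ K) :=
  Ideal.span {g | ∃ f ∈ I, ∃ s : σ, g = pderiv s f}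

/-- `Sing_{≥ k}`: the locus of `S^{(k)}(I) = S(S(⋯ S(I)))`; for `k = 0` it is `V(I)`. -/
noncomputable def singLocus (c : Module.Basis σ K U) (I : Ideal (MvPolynomial σ K)) (k : ℕ) :
    Set (Projectivization K U) :=
  zeroLocus c (singularityIdeal^[k] I)

/-- The points of multiplicity `k ≥ 1`: `Mult_k = Sing_{≥ k-1} - Sing_{≥ k}`. -/
def multLocus (c : Module.Basis σ K U) (I : Ideal (MvPolynomial σ K)) (k : ℕ) :
    Set (Projectivization K U) :=
  {p | 1 ≤ k ∧ p ∈ singLocus c I (k - 1) ∧ p ∉ singLocus c I k}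

/-- `k` is the multiplicity of the variety of `I` at `p`: the point `p` lies in `Mult_k` and in no
other `Mult_j`. -/
def HasMultiplicity (c : Module.Basis σ K U) (I : Ideal (MvPolynomial σ K))
    (p : Projectivization K U) (k : ℕ) : Prop :=
  ∀ j : ℕ, p ∈ multLocus c I j ↔ j = k

/-- The Taylor expansion of `f` at `u`, that is, the polynomial `f(u + A)`. -/
noncomputable def taylorAt (c : Module.Basis σ K U) (u : U) (f : MvPolynomial σ K) :
    MvPolynomial σ K :=
  aeval (fun s => X s + C (c.repr u s)) f

/-- The leading forms at `u` of the homogeneous elements of `I`: the degree `k` part of `f(u + A)`,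
provided that all parts of degree less than `k` vanish. (The zero polynomial may occur as well, which
does not matter for zero sets.) -/
def leadingForms (c : Module.Basis σ K U) (I : Ideal (MvPolynomial σ K)) (u : U) :
    Set (MvPolynomial σ K) :=
  {g | ∃ f ∈ I, ∃ d : ℕ, f.IsHomogeneous d ∧ ∃ k : ℕ,
    (∀ j < k, homogeneousComponent j (taylorAt c u f) = 0) ∧
    g = homogeneousComponent k (taylorAt c u f)}

/-- The representative `a / a_i` of the point `p = [a]` in the chart `A_i = 1`
(meaningful if `a_i ≠ 0`). -/
noncomputable def chartRep (c : Module.Basis σ K U) (p : Projectivization K U) (i : σ) : U :=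
  (c.repr p.rep i)⁻¹ • p.rep

/-- The affine tangent cone at `p = [a]` in the chart `A_i = 1` around `p` (for `a_i ≠ 0`): the zero set
of the leading forms `g(A / A_i - a / a_i)`. -/
noncomputable def affineTangentCone (c : Module.Basis σ K U) (I : Ideal (MvPolynomial σ K))
    (p : Projectivization K U) (i : σ) : Set U :=
  {y | c.repr y i = 1 ∧
    ∀ g ∈ leadingForms c I (chartRep c p i), evalAt c (y - chartRep c p i) g = 0}

/-- The projective tangent cone at `p = [a]`, computed in the chart `A_i = 1` (for `a_i ≠ 0`): the zero
set of the homogenized leading forms `g(a_i A - A_i a)`. -/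
noncomputable def projTangentCone (c : Module.Basis σ K U) (I : Ideal (MvPolynomial σ K))
    (p : Projectivization K U) (i : σ) : Set (Projectivization K U) :=
  {q | ∀ g ∈ leadingForms c I (chartRep c p i),
    evalAt c (c.repr p.rep i • q.rep - c.repr q.rep i • p.rep) g = 0}

/-- The ideal of the linear subvariety `ℙ(M)`, generated by the linear forms that vanish on `M`. -/
noncomputable def linearIdeal (c : Module.Basis σ K U) (M : Submodule K U) : Ideal (MvPolynomial σ K) :=
  Ideal.span {f | f.IsHomogeneous 1 ∧ ∀ u ∈ M, evalAt c u f = 0}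

/-- The points of the linear subvariety `ℙ(M)` of `ℙ(U)`. -/
def linearLocus (M : Submodule K U) : Set (Projectivization K U) :=
  {q | q.rep ∈ M}

end Projective

/-! ### Symmetric bilinear forms and configurations -/

section Forms

variable {K : Type*} [Field K]

/-- `Sym² V^∨`, the space of symmetric bilinear forms on `V`. -/
def SymForm (K : Type*) [Field K] (V : Type*) [AddCommGroup V] [Module K V] :
    Submodule K (V →ₗ[K] V →ₗ[K] K) where
  carrier := {B | ∀ v w, B v w = B w v}
  zero_mem' := fun _ _ => rfl
  add_mem' := by
    intro B B' h h' v w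
    simp only [LinearMap.add_apply, h v w, h' v w]
  smul_mem' := by
    intro r B h v w
    simp only [LinearMap.smul_apply, h v w]

/-- The additive group structure of a submodule; instance search does not find it unaided. -/
instance (K : Type*) [Field K] (V : Type*) [AddCommGroup V] [Module K V] :
    AddCommGroup (SymForm K V) :=
  @Submodule.addCommGroup K (V →ₗ[K] V →ₗ[K] K) _ _ _ (SymForm K V)

/-- The restriction map `π : Sym² V^∨ → Sym² W^∨` for a subspace `W` of `V`. -/
def restrictForm {V : Type*} [AddCommGroup V] [Module K V] (W : Submodule K V) :
    SymForm K V →ₗ[K] SymForm K W where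
  toFun B := ⟨(B : V →ₗ[K] V →ₗ[K] K).compl₁₂ W.subtype W.subtype,
    fun v w => B.2 (v : V) (w : V)⟩
  map_add' _ _ := rfl
  map_smul' _ _ := rfl

variable {E : Type*} [Fintype E]

/-- `B_E : K^E → Sym² (K^E)^∨`, `a ↦ ∑ a_e X_e²`. -/
def diagForm (K : Type*) [Field K] (E : Type*) [Fintype E] :
    (E → K) →ₗ[K] SymForm K (E → K) where
  toFun a := ⟨∑ e, a e • (LinearMap.proj e : (E → K) →ₗ[K] K).smulRight
      (LinearMap.proj e : (E → K) →ₗ[K] K), by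
    intro v w
    simp only [LinearMap.sum_apply, LinearMap.smul_apply, LinearMap.smulRight_apply,
      LinearMap.proj_apply, smul_eq_mul]
    exact Finset.sum_congr rfl fun e _ => by ring⟩
  map_add' a a' := by
    apply Subtype.ext
    simp [add_smul, Finset.sum_add_distrib]
  map_smul' r a := by
    apply Subtype.ext
    simp [Finset.smul_sum, mul_smul]

/-- The family `B_E|_W : K^E → Sym² W^∨` of a configuration `W ⊆ K^E`. -/
def configFamily (W : Submodule K (E → K)) : (E → K) →ₗ[K] SymForm K W :=
  restrictForm W ∘ₗ diagForm K E

/-- The ideal generated by the determinant of a linear family `φ` of symmetric bilinear forms on `W`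
parametrized by `U`, as a polynomial in the coordinates of the basis `c` of `U`. The determinant is
that of the matrix in the basis `β` of `W`; the ideal does not depend on `β`. -/
noncomputable def degeneracyIdeal {U : Type*} [AddCommGroup U] [Module K U] {W : Type*}
    [AddCommGroup W] [Module K W] {σ ι : Type*} [Fintype σ] [Fintype ι] [DecidableEq ι]
    (c : Module.Basis σ K U) (β : Module.Basis ι K W) (φ : U →ₗ[K] SymForm K W) :
    Ideal (MvPolynomial σ K) :=
  Ideal.span {Matrix.det (Matrix.of fun i j : ι =>
    ∑ s, C ((φ (c s) : W →ₗ[K] W →ₗ[K] K) (β i) (β j)) * X s)}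

variable {ι : Type*} [Fintype ι] [DecidableEq ι]

/-- The ideal `⟨Ψ_W⟩` of the configuration hypersurface `X_W ⊆ ℙ(K^E)`. -/
noncomputable def configIdeal (W : Submodule K (E → K)) (β : Module.Basis ι K W) :
    Ideal (MvPolynomial E K) :=
  degeneracyIdeal (Pi.basisFun K E) β (configFamily W)

/-- The ideal of the generic symmetric degeneracy locus `𝔛 ⊆ ℙ(Sym² W^∨)`, in the coordinates of a
basis `b` of `Sym² W^∨`. -/
noncomputable def genericIdeal {W : Type*} [AddCommGroup W] [Module K W] {σ : Type*} [Fintype σ]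
    (b : Module.Basis σ K (SymForm K W)) (β : Module.Basis ι K W) : Ideal (MvPolynomial σ K) :=
  degeneracyIdeal b β LinearMap.id

/-- The vertex `V = ℙ(B_E(A)) ∩ ℙ(Z)`, with `Z` the kernel of the restriction to `W` and
`ℙ(B_E(A))` identified with `ℙ(K^E)`. -/
def vertex (W : Submodule K (E → K)) : Set (Projectivization K (E → K)) :=
  {x | diagForm K E x.rep ∈ LinearMap.ker (restrictForm W)}

/-- The map `π : ℙ(K^E) - V → ℙ(Sym² W^∨)`, `[a] ↦ [B_E(a)|_W]`. -/
noncomputable def piMap (W : Submodule K (E → K))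
    (x : {x : Projectivization K (E → K) // x ∉ vertex W}) : Projectivization K (SymForm K W) :=
  Projectivization.mk K (configFamily W x.1.rep) x.2

/-- The subspace `π(B_E(A))` of `Sym² W^∨`, whose projectivization is `L`. -/
def imageSpace (W : Submodule K (E → K)) : Submodule K (SymForm K W) :=
  LinearMap.range (configFamily W)

end Forms

end ConfigTC

namespace ConfigTC
open MvPolynomial

/-! ### Lowest homogeneous parts of polynomials. -/

section PolynomialLemmas

variable {K : Type*} [Field K] {σ : Type*}

/-! Let `B` be a symmetric form with kernel `N`. In a basis adapted to `N` and a complement, the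
rows of `B + tY` belonging to `N` are divisible by `t`. Hence `det (B + tY) = t ^ dim N * P(t)`,
where `P(0)` is a nonzero constant times `det (Y|_N)` (`exists_det_gram_add_smul`). So for any
linear family of forms, the Taylor expansion of the determinant at a member with kernel `N` starts
in degree `dim N` with the determinant of the family restricted to `N`, unless that determinant
vanishes identically.

For configurations it does not. The restriction of the family of `W` to `N ⊆ W` is the configuration
family of `N`, and its determinant takes the square of a nonzero maximal minor as a value
(`exists_det_gram_configFamily_ne_zero`). The order therefore does not jump on passing from the
generic locus to its linear section. Both multiplicities equal `dim N`, since in characteristic zero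
the multiplicity of a hypersurface is its order of vanishing (`hasMultiplicity_span_singleton`).
Both tangent cones consist of the forms degenerate on `N`.

For the section by `L`, the defining ideal is a sum, which may have further leading forms. Pulled
back to the parameter space, the linear forms die and each leading form becomes a leading form of a
multiple of the configuration polynomial (`pullback_mem_leadingForms`), so no new condition arises
on `L` (`leadingForms_sup_iff`). -/

theorem forall_homogeneousComponent_eq_zero_iff {p : MvPolynomial σ K} {k : ℕ} :
    (∀ j < k, homogeneousComponent j p = 0) ↔ ∀ d : σ →₀ ℕ, d.degree < k → coeff d p = 0 := by
  constructor
  · intro h d hd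
    have := congrArg (coeff d) (h _ hd)
    simpa [coeff_homogeneousComponent] using this
  · intro h j hj
    ext d
    rw [coeff_homogeneousComponent]
    split_ifs with hd
    · rw [h d (hd ▸ hj), coeff_zero]
    · rw [coeff_zero]

theorem homogeneousComponent_eq_zero_of_lt_mul {p q : MvPolynomial σ K} {k l : ℕ}
    (hp : ∀ j < k, homogeneousComponent j p = 0) (hq : ∀ j < l, homogeneousComponent j q = 0) :
    ∀ j < k + l, homogeneousComponent j (p * q) = 0 := by
  classical
  rw [forall_homogeneousComponent_eq_zero_iff] at *
  intro d hd
  rw [coeff_mul]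
  refine Finset.sum_eq_zero fun x hx => ?_
  have h : x.1.degree + x.2.degree = d.degree := by
    rw [← Finset.HasAntidiagonal.mem_antidiagonal.mp hx, map_add]
  rcases lt_or_ge x.1.degree k with h1 | h1
  · rw [hp _ h1, zero_mul]
  · rw [hq _ (by omega), mul_zero]

/-- In total degree `k + l`, a factor above its lowest degree forces the other one below its own, so
only the two lowest parts contribute. -/
theorem homogeneousComponent_add_mul {p q : MvPolynomial σ K} {k l : ℕ}
    (hp : ∀ j < k, homogeneousComponent j p = 0) (hq : ∀ j < l, homogeneousComponent j q = 0) :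
    homogeneousComponent (k + l) (p * q) =
      homogeneousComponent k p * homogeneousComponent l q := by
  classical
  rw [forall_homogeneousComponent_eq_zero_iff] at hp hq
  ext d
  rw [coeff_homogeneousComponent]
  split_ifs with hd
  · rw [coeff_mul, coeff_mul]
    refine Finset.sum_congr rfl fun x hx => ?_
    have h : x.1.degree + x.2.degree = d.degree := by
      rw [← Finset.HasAntidiagonal.mem_antidiagonal.mp hx, map_add]
    rw [coeff_homogeneousComponent, coeff_homogeneousComponent]
    rcases lt_trichotomy x.1.degree k with h1 | h1 | h1
    · rw [hp _ h1, if_neg h1.ne, zero_mul, zero_mul]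
    · rw [if_pos h1, if_pos (by omega)]
    · rw [hq _ (by omega : x.2.degree < l), if_neg h1.ne', mul_zero, zero_mul]
  · exact (((homogeneousComponent_isHomogeneous k p).mul
      (homogeneousComponent_isHomogeneous l q)).coeff_eq_zero hd).symm

theorem exists_lowest_homogeneousComponent {p : MvPolynomial σ K} (hp : p ≠ 0) :
    ∃ r : ℕ, (∀ j < r, homogeneousComponent j p = 0) ∧ homogeneousComponent r p ≠ 0 := by
  classical
  have h : ∃ r : ℕ, homogeneousComponent r p ≠ 0 := by
    by_contra! h
    exact hp (by rw [← sum_homogeneousComponent p, Finset.sum_eq_zero fun i _ => h i])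
  exact ⟨Nat.find h, fun j hj => not_not.mp (Nat.find_min h hj), Nat.find_spec h⟩

/-- The leading forms of the multiples of `q` are multiples of the leading form of `q`. -/
theorem dvd_homogeneousComponent_mul {p q : MvPolynomial σ K} {k l : ℕ}
    (hq : ∀ j < l, homogeneousComponent j q = 0) (hql : homogeneousComponent l q ≠ 0)
    (hpq : ∀ j < k, homogeneousComponent j (p * q) = 0) :
    homogeneousComponent l q ∣ homogeneousComponent k (p * q) := by
  rcases eq_or_ne p 0 with rfl | hp
  · simp
  obtain ⟨r, hr, hr'⟩ := exists_lowest_homogeneousComponent hp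
  have hmul := homogeneousComponent_add_mul hr hq
  -- The order of the product is exactly `r + l`. Below it the part is zero; degrees above it are
  -- excluded by `hpq`.
  rcases lt_trichotomy k (r + l) with h | rfl | h
  · rw [homogeneousComponent_eq_zero_of_lt_mul hr hq k h]
    exact dvd_zero _
  · rw [hmul]
    exact dvd_mul_left _ _
  · exact absurd (hpq _ h) (hmul ▸ mul_ne_zero hr' hql)

theorem pderiv_homogeneousComponent_succ (s : σ) (k : ℕ) (p : MvPolynomial σ K) :
    pderiv s (homogeneousComponent (k + 1) p) = homogeneousComponent k (pderiv s p) := by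
  ext d
  rw [coeff_homogeneousComponent, coeff_pderiv, coeff_pderiv, coeff_homogeneousComponent]
  simp only [map_add, Finsupp.degree_single, add_left_inj]
  split_ifs <;> simp

/-- By Euler's identity, vanishing of all partial derivatives would give `(k + 1) • p = 0`. -/
theorem exists_pderiv_ne_zero [Fintype σ] [CharZero K] {p : MvPolynomial σ K} {k : ℕ}
    (hp : p.IsHomogeneous (k + 1)) (h : p ≠ 0) : ∃ s, pderiv s p ≠ 0 := by
  by_contra! hs
  have := hp.sum_X_mul_pderiv
  simp only [hs, mul_zero, Finset.sum_const_zero] at this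
  rw [eq_comm, ← Nat.cast_smul_eq_nsmul K, smul_eq_zero] at this
  exact this.elim (by exact_mod_cast Nat.succ_ne_zero k) h

theorem aeval_homogeneousComponent {τ : Type*} (g : σ → MvPolynomial τ K)
    (hg : ∀ s, (g s).IsHomogeneous 1) (k : ℕ) (p : MvPolynomial σ K) :
    aeval g (homogeneousComponent k p) = homogeneousComponent k (aeval g p) := by
  induction p using MvPolynomial.induction_on' with
  | monomial d r =>
    have h := (isHomogeneous_monomial (n := d.degree) r rfl).aeval g hg
    rw [one_mul] at h
    rw [homogeneousComponent_of_mem (isHomogeneous_monomial r rfl),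
      homogeneousComponent_of_mem h]
    split_ifs <;> simp
  | add p q hp hq => rw [map_add, map_add, map_add, map_add, hp, hq]

end PolynomialLemmas

/-! ### Evaluation in coordinates and Taylor expansion. -/

section Evaluation

variable {K : Type*} [Field K] {U : Type*} [AddCommGroup U] [Module K U] {σ : Type*}
  (c : Module.Basis σ K U)

theorem evalAt_mul (u : U) (f g : MvPolynomial σ K) :
    evalAt c u (f * g) = evalAt c u f * evalAt c u g := map_mul _ _ _

theorem evalAt_ext [Finite σ] [Infinite K] {f g : MvPolynomial σ K}
    (h : ∀ u, evalAt c u f = evalAt c u g) : f = g := by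
  have := Fintype.ofFinite σ
  refine MvPolynomial.funext fun x => ?_
  have := h (c.equivFun.symm x)
  have hx : (fun s => c.repr (c.equivFun.symm x) s) = x := by
    ext s
    rw [← c.equivFun_apply, LinearEquiv.apply_symm_apply]
  simpa only [evalAt, hx] using this

theorem taylorAt_mul (u : U) (f g : MvPolynomial σ K) :
    taylorAt c u (f * g) = taylorAt c u f * taylorAt c u g := map_mul _ _ _

theorem evalAt_taylorAt (u y : U) (f : MvPolynomial σ K) :
    evalAt c y (taylorAt c u f) = evalAt c (u + y) f := by
  simp only [evalAt, taylorAt, aeval_def, algebraMap_eq, ← coe_eval₂Hom]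
  rw [← RingHom.comp_apply]
  congr 1
  ext s
  · simp
  · simp [add_comm]

theorem pderiv_taylorAt (s : σ) (u : U) (f : MvPolynomial σ K) :
    pderiv s (taylorAt c u f) = taylorAt c u (pderiv s f) := by
  classical
  induction f using MvPolynomial.induction_on with
  | C r => simp [taylorAt]
  | add p q hp hq => simpa [taylorAt] using congrArg₂ (· + ·) hp hq
  | mul_X p t hp =>
    have hX : pderiv s (taylorAt c u (X t)) = taylorAt c u (pderiv s (X t)) := by
      simp only [taylorAt, aeval_X, map_add, pderiv_C, add_zero, pderiv_X]
      rcases eq_or_ne t s with rfl | h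
      · simp
      · simp [Pi.single_eq_of_ne h]
    have hadd : ∀ a b, taylorAt c u (a + b) = taylorAt c u a + taylorAt c u b := map_add _
    rw [taylorAt_mul, Derivation.leibniz, Derivation.leibniz, hadd]
    simp only [smul_eq_mul, taylorAt_mul, hp, hX]

theorem evalAt_smul_of_isHomogeneous {f : MvPolynomial σ K} {d : ℕ} (hf : f.IsHomogeneous d)
    (t : K) (u : U) : evalAt c (t • u) f = t ^ d * evalAt c u f := by
  simp only [evalAt, eval_eq, Finset.mul_sum]
  refine Finset.sum_congr rfl fun m hm => ?_
  have hd : ∑ i ∈ m.support, m i = d := by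
    by_contra h
    exact mem_support_iff.mp hm (hf.coeff_eq_zero h)
  simp only [map_smul, Finsupp.smul_apply, smul_eq_mul, mul_pow, Finset.prod_mul_distrib,
    Finset.prod_pow_eq_pow_sum, hd]
  ring

theorem homogeneousComponent_zero_taylorAt (u : U) (f : MvPolynomial σ K) :
    homogeneousComponent 0 (taylorAt c u f) = C (evalAt c u f) := by
  rw [homogeneousComponent_zero, ← constantCoeff_eq, ← add_zero u, ← evalAt_taylorAt c u 0, add_zero]
  simp [evalAt, ← eval_zero]

/-- The homogeneous parts of `f(u + A)` at `y` are the coefficients of `t ↦ f(u + t y)`. -/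
theorem evalAt_homogeneousComponent_taylorAt [Infinite K] (u y : U) (f : MvPolynomial σ K)
    (P : Polynomial K) (hP : ∀ t : K, evalAt c (u + t • y) f = P.eval t) (k : ℕ) :
    evalAt c y (homogeneousComponent k (taylorAt c u f)) = P.coeff k := by
  set T := taylorAt c u f with hT
  have hsum : P = ∑ j ∈ Finset.range (T.totalDegree + 1),
      Polynomial.C (evalAt c y (homogeneousComponent j T)) * Polynomial.X ^ j := by
    refine Polynomial.funext fun t => ?_
    rw [← hP, ← evalAt_taylorAt, ← hT]
    conv_lhs => rw [← sum_homogeneousComponent T]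
    rw [evalAt, map_sum, Polynomial.eval_finsetSum]
    refine Finset.sum_congr rfl fun j _ => ?_
    have := evalAt_smul_of_isHomogeneous c (homogeneousComponent_isHomogeneous j T) t y
    rw [evalAt] at this
    rw [this, Polynomial.eval_mul, Polynomial.eval_C, Polynomial.eval_pow, Polynomial.eval_X,
      mul_comm]
  rw [hsum, Polynomial.finsetSum_coeff]
  simp only [Polynomial.coeff_C_mul, Polynomial.coeff_X_pow, mul_ite, mul_one, mul_zero,
    Finset.sum_ite_eq, Finset.mem_range]
  split_ifs with hk
  · rfl
  · rw [homogeneousComponent_eq_zero _ _ (by omega)]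
    exact map_zero _

end Evaluation

/-! ### Iterated singularity ideals, multiplicity and leading forms of hypersurfaces. -/

section Multiplicity

variable {K : Type*} [Field K] {U : Type*} [AddCommGroup U] [Module K U] {σ : Type*}
  (c : Module.Basis σ K U)

/-- The Leibniz rule recovers `f` as `∂(X f) - X ∂f`. A coordinate must exist, since otherwise the
singularity ideal is zero. The inclusion makes the loci `singLocus` a decreasing chain. -/
theorem le_singularityIdeal [Nonempty σ] (I : Ideal (MvPolynomial σ K)) :
    I ≤ singularityIdeal I := by
  intro f hf
  obtain ⟨s⟩ := ‹Nonempty σ›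
  have h1 : pderiv s (X s * f) ∈ singularityIdeal I :=
    Ideal.subset_span ⟨_, I.mul_mem_left _ hf, s, rfl⟩
  have h2 : X s * pderiv s f ∈ singularityIdeal I :=
    Ideal.mul_mem_left _ _ (Ideal.subset_span ⟨f, hf, s, rfl⟩)
  have h3 : f = pderiv s (X s * f) - X s * pderiv s f := by
    rw [pderiv_mul, pderiv_X_self]
    ring
  rw [h3]
  exact Ideal.sub_mem _ h1 h2

theorem iterate_singularityIdeal_mono [Nonempty σ] (I : Ideal (MvPolynomial σ K)) :
    Monotone fun k => singularityIdeal^[k] I := by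
  refine monotone_nat_of_le_succ fun k => ?_
  rw [Function.iterate_succ_apply']
  exact le_singularityIdeal _

/-- A derivative lowers the order of vanishing by at most one, and multiplication by ring elements
does not lower it. -/
theorem homogeneousComponent_taylorAt_singularityIdeal {I : Ideal (MvPolynomial σ K)} {u : U}
    {k : ℕ} (hI : ∀ f ∈ I, ∀ j < k + 1, homogeneousComponent j (taylorAt c u f) = 0) :
    ∀ f ∈ singularityIdeal I, ∀ j < k, homogeneousComponent j (taylorAt c u f) = 0 := by
  intro f hf
  induction hf using Submodule.span_induction with
  | mem g hg =>
    obtain ⟨f, hf, s, rfl⟩ := hg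
    intro j hj
    rw [← pderiv_taylorAt, ← pderiv_homogeneousComponent_succ, hI f hf _ (by omega), map_zero]
  | zero => simp [taylorAt]
  | add f g _ _ hf hg =>
    intro j hj
    have : taylorAt c u (f + g) = taylorAt c u f + taylorAt c u g := map_add _ _ _
    rw [this, map_add, hf j hj, hg j hj, add_zero]
  | smul a f _ hf =>
    intro j hj
    rw [smul_eq_mul, taylorAt_mul]
    exact homogeneousComponent_eq_zero_of_lt_mul (k := 0) (by simp) hf j (by omega)

theorem homogeneousComponent_taylorAt_iterate (u : U) {k : ℕ} (l : ℕ)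
    {I : Ideal (MvPolynomial σ K)}
    (hI : ∀ f ∈ I, ∀ j < k + l, homogeneousComponent j (taylorAt c u f) = 0) :
    ∀ f ∈ singularityIdeal^[l] I, ∀ j < k, homogeneousComponent j (taylorAt c u f) = 0 := by
  induction l generalizing I with
  | zero => exact hI
  | succ l ih =>
    rw [Function.iterate_succ_apply]
    exact ih (homogeneousComponent_taylorAt_singularityIdeal c hI)

/-- A nonzero part of positive degree has a nonzero derivative in some coordinate direction; after
`k` such steps a nonzero constant term is left. The witness is kept homogeneous because `zeroLocus`
tests only homogeneous elements. -/
theorem exists_mem_iterate_evalAt_ne_zero [Fintype σ] [CharZero K] (u : U) (k : ℕ)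
    {I : Ideal (MvPolynomial σ K)} {f : MvPolynomial σ K} {d : ℕ} (hf : f ∈ I)
    (hd : f.IsHomogeneous d) (h : homogeneousComponent k (taylorAt c u f) ≠ 0) :
    ∃ g ∈ singularityIdeal^[k] I, (∃ d, g.IsHomogeneous d) ∧ evalAt c u g ≠ 0 := by
  induction k generalizing I f d with
  | zero =>
    refine ⟨f, hf, ⟨d, hd⟩, fun h0 => h ?_⟩
    rw [homogeneousComponent_zero_taylorAt, h0, C_0]
  | succ k ih =>
    obtain ⟨s, hs⟩ := exists_pderiv_ne_zero (homogeneousComponent_isHomogeneous _ _) h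
    rw [pderiv_homogeneousComponent_succ, pderiv_taylorAt] at hs
    rw [Function.iterate_succ_apply]
    exact ih (Ideal.subset_span ⟨f, hf, s, rfl⟩) hd.pderiv hs

/-- The multiplicity of a hypersurface is the order of vanishing of its equation. -/
theorem hasMultiplicity_span_singleton [Fintype σ] [CharZero K] {f : MvPolynomial σ K} {d r : ℕ}
    (hd : f.IsHomogeneous d) (p : Projectivization K U) (hr : 1 ≤ r)
    (hlt : ∀ j < r, homogeneousComponent j (taylorAt c p.rep f) = 0)
    (hne : homogeneousComponent r (taylorAt c p.rep f) ≠ 0) :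
    HasMultiplicity c (Ideal.span {f}) p r := by
  have hσ : Nonempty σ := by
    by_contra h
    rw [not_nonempty_iff] at h
    have := c.repr.injective.subsingleton
    exact p.rep_nonzero (Subsingleton.elim _ _)
  have key : ∀ k, p ∈ singLocus c (Ideal.span {f}) k ↔ k < r := by
    intro k
    constructor
    · intro hk
      by_contra! hle
      obtain ⟨g, hg, ⟨e, he⟩, hg0⟩ := exists_mem_iterate_evalAt_ne_zero c p.rep r
        (Ideal.subset_span (Set.mem_singleton f)) hd hne
      exact hg0 (hk g (iterate_singularityIdeal_mono _ hle hg) e he)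
    · intro hk g hg _ _
      -- Elements of the ideal vanish to order `r ≥ 1 + k`, so after `k` iterations order at least
      -- one remains, that is, vanishing at `p`.
      have h0 := homogeneousComponent_taylorAt_iterate c p.rep (k := 1) k
        (I := Ideal.span {f}) (fun f' hf' j hj => by
          obtain ⟨a, rfl⟩ := Ideal.mem_span_singleton'.mp hf'
          rw [taylorAt_mul]
          exact homogeneousComponent_eq_zero_of_lt_mul (k := 0) (by simp) hlt j (by omega))
        g hg 0 one_pos
      rwa [homogeneousComponent_zero_taylorAt, C_eq_zero] at h0
  intro j
  simp only [multLocus, Set.mem_ofPred_eq, key]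
  omega

/-- A vector kills the leading forms of a hypersurface if and only if it kills that of its equation. -/
theorem leadingForms_span_singleton_iff {f : MvPolynomial σ K} {d r : ℕ}
    (hd : f.IsHomogeneous d) {u : U}
    (hlt : ∀ j < r, homogeneousComponent j (taylorAt c u f) = 0)
    (hne : homogeneousComponent r (taylorAt c u f) ≠ 0) (v : U) :
    (∀ g ∈ leadingForms c (Ideal.span {f}) u, evalAt c v g = 0) ↔
      evalAt c v (homogeneousComponent r (taylorAt c u f)) = 0 := by
  constructor
  · intro h
    exact h _ ⟨f, Ideal.subset_span (Set.mem_singleton f), d, hd, r, hlt, rfl⟩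
  · rintro h g ⟨f', hf', _, _, k, hk, rfl⟩
    obtain ⟨a, rfl⟩ := Ideal.mem_span_singleton'.mp hf'
    rw [taylorAt_mul] at hk ⊢
    obtain ⟨q, hq⟩ := dvd_homogeneousComponent_mul hlt hne hk
    rw [hq, evalAt_mul, h, zero_mul]

theorem leadingForms_mono {I J : Ideal (MvPolynomial σ K)} (h : I ≤ J) (u : U) :
    leadingForms c I u ⊆ leadingForms c J u := by
  rintro g ⟨f, hf, hg⟩
  exact ⟨f, h hf, hg⟩

end Multiplicity

/-! ### Pullback of polynomials along a linear map. -/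

section Pullback

variable {K : Type*} [Field K] {U U' : Type*} [AddCommGroup U] [Module K U]
  [AddCommGroup U'] [Module K U'] {σ τ : Type*} [Fintype τ]

/-- The pullback of polynomials along a linear map, in coordinates. -/
noncomputable def pullback (c : Module.Basis τ K U) (b : Module.Basis σ K U') (φ : U →ₗ[K] U') :
    MvPolynomial σ K →ₐ[K] MvPolynomial τ K :=
  aeval fun s => ∑ e, C (b.repr (φ (c e)) s) * X e

variable (c : Module.Basis τ K U) (b : Module.Basis σ K U') (φ : U →ₗ[K] U')

theorem evalAt_pullback (u : U) (f : MvPolynomial σ K) :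
    evalAt c u (pullback c b φ f) = evalAt b (φ u) f := by
  simp only [evalAt, pullback, aeval_def, algebraMap_eq, ← coe_eval₂Hom]
  rw [← RingHom.comp_apply]
  congr 1
  ext s
  · simp
  · have h : φ u = ∑ e, c.repr u e • φ (c e) := by
      conv_lhs => rw [← c.sum_repr u]
      simp only [map_sum, map_smul]
    simp [h, Finsupp.finsetSum_apply, mul_comm]

theorem homogeneousComponent_pullback (k : ℕ) (f : MvPolynomial σ K) :
    pullback c b φ (homogeneousComponent k f) = homogeneousComponent k (pullback c b φ f) :=
  aeval_homogeneousComponent _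
    (fun _ => IsHomogeneous.sum _ _ _ fun _ _ => isHomogeneous_C_mul_X _ _) _ _

theorem isHomogeneous_pullback {f : MvPolynomial σ K} {d : ℕ} (hf : f.IsHomogeneous d) :
    (pullback c b φ f).IsHomogeneous d := by
  rw [← homogeneousComponent_eq_self hf, homogeneousComponent_pullback]
  exact homogeneousComponent_isHomogeneous _ _

theorem taylorAt_pullback [Infinite K] (u : U) (f : MvPolynomial σ K) :
    taylorAt c u (pullback c b φ f) = pullback c b φ (taylorAt b (φ u) f) := by
  refine evalAt_ext c fun y => ?_
  rw [evalAt_taylorAt, evalAt_pullback, evalAt_pullback, evalAt_taylorAt, map_add]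

theorem pullback_eq_zero_of_mem_linearIdeal [Infinite K] {f : MvPolynomial σ K}
    (hf : f ∈ linearIdeal b (LinearMap.range φ)) : pullback c b φ f = 0 := by
  have : linearIdeal b (LinearMap.range φ) ≤ RingHom.ker (pullback c b φ) := by
    refine Ideal.span_le.mpr fun l hl => ?_
    refine evalAt_ext c fun u => ?_
    rw [evalAt_pullback, hl.2 _ ⟨u, rfl⟩]
    exact (map_zero _).symm
  exact this hf

/-- Pullbacks of leading forms are leading forms of the pullback. -/
theorem pullback_mem_leadingForms [Infinite K] {F g : MvPolynomial σ K} {u : U}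
    (hg : g ∈ leadingForms b (linearIdeal b (LinearMap.range φ) ⊔ Ideal.span {F}) (φ u)) :
    pullback c b φ g ∈ leadingForms c (Ideal.span {pullback c b φ F}) u := by
  obtain ⟨f, hf, d, hd, k, hk, rfl⟩ := hg
  refine ⟨pullback c b φ f, ?_, d, isHomogeneous_pullback c b φ hd, k, fun j hj => ?_, ?_⟩
  -- The linear part of an element of the sum pulls back to zero, which leaves a multiple of the
  -- pullback of `F`.
  · obtain ⟨l, hl, h, hh, rfl⟩ := Submodule.mem_sup.mp hf
    obtain ⟨a, rfl⟩ := Ideal.mem_span_singleton'.mp hh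
    rw [map_add, pullback_eq_zero_of_mem_linearIdeal c b φ hl, zero_add, map_mul]
    exact Ideal.mul_mem_left _ _ (Ideal.subset_span rfl)
  · rw [taylorAt_pullback, ← homogeneousComponent_pullback, hk j hj, map_zero]
  · rw [taylorAt_pullback, homogeneousComponent_pullback]

end Pullback

/-! ### Leading forms coming from the equations of a linear space. -/

section LinearSection

variable {K : Type*} [Field K] {U : Type*} [AddCommGroup U] [Module K U] {σ : Type*} [Fintype σ]
  (b : Module.Basis σ K U) (M : Submodule K U)

/-- A linear form vanishing on `M` is unchanged by translation by `u ∈ M`, hence is its own leading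
form there; such forms separate `M` from any vector outside it. -/
theorem mem_of_forall_leadingForms [Infinite K] {I : Ideal (MvPolynomial σ K)} {u v : U}
    (hu : u ∈ M) (h : ∀ g ∈ leadingForms b (linearIdeal b M ⊔ I) u, evalAt b v g = 0) :
    v ∈ M := by
  by_contra hv
  obtain ⟨l, hl, hM⟩ := Submodule.exists_le_ker_of_notMem hv
  obtain ⟨f, hf, key⟩ : ∃ f : MvPolynomial σ K, f.IsHomogeneous 1 ∧ ∀ u, evalAt b u f = l u := by
    refine ⟨∑ s, C (l (b s)) * X s,
      IsHomogeneous.sum _ _ _ fun _ _ => isHomogeneous_C_mul_X _ _, fun u => ?_⟩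
    have h : l u = ∑ s, b.repr u s • l (b s) := by
      conv_lhs => rw [← b.sum_repr u]
      simp only [map_sum, map_smul]
    simp [evalAt, h, mul_comm]
  refine hl ?_
  rw [← key]
  refine h f ⟨f, Ideal.mem_sup_left (Ideal.subset_span ⟨hf, fun u hu => ?_⟩), 1, hf, 1, ?_⟩
  · rw [key]
    exact hM hu
  have hT : taylorAt b u f = f := by
    refine evalAt_ext b fun y => ?_
    rw [evalAt_taylorAt, key, key, map_add, LinearMap.mem_ker.mp (hM hu), zero_add]
  rw [hT, homogeneousComponent_eq_self hf]
  refine ⟨fun j hj => ?_, rfl⟩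
  rw [homogeneousComponent_of_mem hf, if_neg (by omega)]

end LinearSection

/-! ### Taylor expansion of the determinant of a family of symmetric forms. -/

section Degeneracy

variable {K : Type*} [Field K] {W : Type*} [AddCommGroup W] [Module K W]

/-- The Gram matrix of a bilinear form on a family of vectors. -/
def gram {ι : Type*} (B : W →ₗ[K] W →ₗ[K] K) (v : ι → W) : Matrix ι ι K :=
  Matrix.of fun i j => B (v i) (v j)

/-- The determinants of the Gram matrices in two bases differ by a nonzero constant. -/
theorem exists_det_gram_eq {ι κ : Type*} [Fintype ι] [DecidableEq ι] [Fintype κ] [DecidableEq κ]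
    (β : Module.Basis ι K W) (β' : Module.Basis κ K W) :
    ∃ r : K, r ≠ 0 ∧ ∀ B : W →ₗ[K] W →ₗ[K] K, (gram B β).det = r * (gram B β').det := by
  let e := β'.indexEquiv β
  let β₀ := β'.reindex e
  have hu : (β₀.toMatrix β).det ≠ 0 := by
    have := congrArg Matrix.det (β₀.toMatrix_mul_toMatrix_flip β)
    rw [Matrix.det_mul, Matrix.det_one] at this
    exact left_ne_zero_of_mul_eq_one this
  refine ⟨(β₀.toMatrix β).det * (β₀.toMatrix β).det, mul_ne_zero hu hu, fun B => ?_⟩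
  have h1 : gram B β = LinearMap.toMatrix₂ β β B := by
    ext i j
    simp [gram, LinearMap.toMatrix₂_apply]
  have h2 : (gram B β').det = (LinearMap.toMatrix₂ β₀ β₀ B).det := by
    rw [← Matrix.det_reindex_self e]
    congr 1
    ext i j
    simp [gram, LinearMap.toMatrix₂_apply, β₀]
  rw [h1, h2, ← LinearMap.toMatrix₂_mul_basis_toMatrix β₀ β₀ β β B, Matrix.det_mul,
    Matrix.det_mul, Matrix.det_transpose]
  ring

/-- As a polynomial in `t`, the determinant of `B + t Y` vanishes to order at least the dimension of the
kernel `N` of `B`, and its coefficient in that degree is the determinant of `Y` on `N`, up to a nonzero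
constant that depends only on `B`. -/
theorem exists_det_gram_add_smul {ι κ : Type*} [Fintype ι] [DecidableEq ι]
    [Fintype κ] [DecidableEq κ] (β : Module.Basis ι K W) {B : W →ₗ[K] W →ₗ[K] K}
    (hB : ∀ v w, B v w = B w v) {N : Submodule K W} (hN : ∀ w, w ∈ N ↔ ∀ w', B w w' = 0)
    (γ : Module.Basis κ K N) :
    ∃ r : K, r ≠ 0 ∧ ∀ Y : W →ₗ[K] W →ₗ[K] K, ∃ P : Polynomial K,
      P.coeff 0 = r * (gram Y fun k => (γ k : W)).det ∧
      ∀ t : K, (gram (B + t • Y) β).det = (Polynomial.X ^ Fintype.card κ * P).eval t := by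
  have := Module.Basis.finiteDimensional_of_finite β
  obtain ⟨N', hN'⟩ := N.exists_isCompl
  let δ := Module.finBasis K N'
  let β' : Module.Basis (Fin (Module.finrank K N') ⊕ κ) K W :=
    (δ.prod γ).map (Submodule.prodEquivOfIsCompl N' N hN'.symm)
  have hβl : ∀ i, β' (Sum.inl i) = δ i := by simp [β']
  have hβr : ∀ k, β' (Sum.inr k) = γ k := by simp [β']
  obtain ⟨r, hr, hdet⟩ := exists_det_gram_eq β β'
  have hzero : ∀ k w, B (γ k) w = 0 := fun k w => (hN _).mp (γ k).2 w
  have hzero' : ∀ k w, B w (γ k) = 0 := fun k w => by rw [hB, hzero]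
  let B₁ := gram B fun i => (δ i : W)
  -- `B` is nondegenerate on the complement: a vector of `N'` orthogonal to `N'` is also orthogonal
  -- to the kernel `N`, so it lies in `N ∩ N' = 0`.
  have hB₁ : B₁.det ≠ 0 := by
    intro h0
    obtain ⟨x, hx, hxB⟩ := Matrix.exists_vecMul_eq_zero_iff.mpr h0
    let v : N' := ∑ i, x i • δ i
    have hv : (v : W) = ∑ i, x i • (δ i : W) := by simp [v]
    have hvN : (v : W) ∈ N := by
      refine (hN _).mpr fun w => ?_
      have : B v = 0 := by
        refine β'.ext fun j => ?_
        rcases j with j | j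
        · have := congrFun hxB j
          simpa [hβl, hv, Matrix.vecMul, dotProduct, B₁, gram] using this
        · rw [hβr, hzero', LinearMap.zero_apply]
      rw [this, LinearMap.zero_apply]
    have hv0 : v = 0 := by
      have := Submodule.disjoint_def.mp hN'.disjoint _ hvN v.2
      exact_mod_cast this
    exact hx (funext fun i => Fintype.linearIndependent_iff.mp δ.linearIndependent x hv0 i)
  refine ⟨r * B₁.det, mul_ne_zero hr hB₁, fun Y => ?_⟩
  let Y₁₁ : Matrix (Fin (Module.finrank K N')) (Fin (Module.finrank K N')) K :=
    Matrix.of fun i j => Y (δ i) (δ j)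
  let Y₁₂ : Matrix (Fin (Module.finrank K N')) κ K := Matrix.of fun i j => Y (δ i) (γ j)
  let Y₂₁ : Matrix κ (Fin (Module.finrank K N')) K := Matrix.of fun i j => Y (γ i) (δ j)
  let Y₂₂ : Matrix κ κ K := gram Y fun k => (γ k : W)
  -- The Gram matrix of `B + tY` in the adapted basis, with the factor `t` removed from the kernel
  -- rows. At `t = 0` it is block triangular with diagonal blocks `B₁` and `Y₂₂`.
  let D : Matrix _ _ (Polynomial K) := Matrix.fromBlocks
    (B₁.map Polynomial.C + (Polynomial.X : Polynomial K) • Y₁₁.map Polynomial.C)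
    ((Polynomial.X : Polynomial K) • Y₁₂.map Polynomial.C)
    (Y₂₁.map Polynomial.C) (Y₂₂.map Polynomial.C)
  have heval : ∀ t, D.det.eval t =
      (Matrix.fromBlocks (B₁ + t • Y₁₁) (t • Y₁₂) Y₂₁ Y₂₂).det := by
    intro t
    rw [← Polynomial.coe_evalRingHom, RingHom.map_det]
    congr 1
    ext i j
    rcases i with i | i <;> rcases j with j | j <;> simp [D, mul_comm t]
  refine ⟨Polynomial.C r * D.det, ?_, fun t => ?_⟩
  · rw [Polynomial.coeff_C_mul, Polynomial.coeff_zero_eq_eval_zero, heval]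
    simp only [zero_smul, add_zero]
    rw [Matrix.det_fromBlocks_zero₁₂]
    ring
  · rw [hdet, Polynomial.eval_mul, Polynomial.eval_mul, Polynomial.eval_C, heval,
      Polynomial.eval_pow, Polynomial.eval_X]
    have hblock : gram (B + t • Y) β' =
        Matrix.fromBlocks 1 0 0 (t • (1 : Matrix κ κ K)) *
          Matrix.fromBlocks (B₁ + t • Y₁₁) (t • Y₁₂) Y₂₁ Y₂₂ := by
      rw [Matrix.fromBlocks_multiply]
      ext i j
      rcases i with i | i <;> rcases j with j | j <;>
        simp [gram, hβl, hβr, hzero, hzero', B₁, Y₁₁, Y₁₂, Y₂₁, Y₂₂]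
    rw [hblock, Matrix.det_mul, Matrix.det_fromBlocks_zero₁₂, Matrix.det_one, one_mul,
      Matrix.det_smul, Matrix.det_one, mul_one]
    ring

variable {U : Type*} [AddCommGroup U] [Module K U] {σ ι : Type*} [Fintype σ] [Fintype ι]
  [DecidableEq ι]

/-- The determinant of a linear family of symmetric forms, as a polynomial in the coordinates. -/
noncomputable def familyDet (c : Module.Basis σ K U) (β : Module.Basis ι K W)
    (φ : U →ₗ[K] SymForm K W) : MvPolynomial σ K :=
  Matrix.det (Matrix.of fun i j : ι =>
    ∑ s, C ((φ (c s) : W →ₗ[K] W →ₗ[K] K) (β i) (β j)) * X s)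

variable (c : Module.Basis σ K U) (β : Module.Basis ι K W) (φ : U →ₗ[K] SymForm K W)

theorem isHomogeneous_familyDet : (familyDet c β φ).IsHomogeneous (Fintype.card ι) := by
  rw [familyDet, Matrix.det_apply]
  refine IsHomogeneous.sum _ _ _ fun τ _ => ?_
  have h : (∏ i, Matrix.of (fun i j : ι =>
      ∑ s, C ((φ (c s) : W →ₗ[K] W →ₗ[K] K) (β i) (β j)) * X s) (τ i) i).IsHomogeneous
        (∑ _i : ι, 1) :=
    IsHomogeneous.prod _ _ _ fun _ _ => IsHomogeneous.sum _ _ _ fun _ _ =>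
      isHomogeneous_C_mul_X _ _
  rw [Finset.sum_const, Finset.card_univ, smul_eq_mul, mul_one] at h
  exact (homogeneousSubmodule σ K _).toAddSubgroup.zsmul_mem h _

theorem evalAt_familyDet (u : U) :
    evalAt c u (familyDet c β φ) = (gram (φ u : W →ₗ[K] W →ₗ[K] K) β).det := by
  rw [evalAt, familyDet, RingHom.map_det]
  congr 1
  ext i j
  have h : φ u = ∑ s, c.repr u s • φ (c s) := by
    conv_lhs => rw [← c.sum_repr u]
    simp only [map_sum, map_smul]
  simp [gram, h, mul_comm]

/-- The Taylor expansion of the determinant at a form with kernel `N` starts in degree `dim N`, with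
the determinant of the restriction to `N`. -/
theorem exists_taylorAt_familyDet [Infinite K] {κ : Type*} [Fintype κ] [DecidableEq κ] (u : U)
    {N : Submodule K W} (hN : ∀ w, w ∈ N ↔ ∀ w', (φ u : W →ₗ[K] W →ₗ[K] K) w w' = 0)
    (γ : Module.Basis κ K N) :
    (∀ j < Fintype.card κ, homogeneousComponent j (taylorAt c u (familyDet c β φ)) = 0) ∧
    ∃ r : K, r ≠ 0 ∧ ∀ y,
      evalAt c y (homogeneousComponent (Fintype.card κ) (taylorAt c u (familyDet c β φ))) =
        r * (gram (φ y : W →ₗ[K] W →ₗ[K] K) fun k => (γ k : W)).det := by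
  obtain ⟨r, hr, h⟩ := exists_det_gram_add_smul β (φ u).2 hN γ
  have key : ∀ y, ∃ P : Polynomial K,
      P.coeff 0 = r * (gram (φ y : W →ₗ[K] W →ₗ[K] K) fun k => (γ k : W)).det ∧
      ∀ k, evalAt c y (homogeneousComponent k (taylorAt c u (familyDet c β φ))) =
        (Polynomial.X ^ Fintype.card κ * P).coeff k := by
    intro y
    obtain ⟨P, hP0, hP⟩ := h (φ y)
    refine ⟨P, hP0, evalAt_homogeneousComponent_taylorAt c u y _ _ fun t => ?_⟩
    rw [evalAt_familyDet, ← hP, map_add, map_smul]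
    rfl
  refine ⟨fun j hj => evalAt_ext c fun y => ?_, r, hr, fun y => ?_⟩
  · obtain ⟨P, -, hP⟩ := key y
    rw [hP, Polynomial.coeff_X_pow_mul', if_neg (by omega)]
    exact (map_zero _).symm
  · obtain ⟨P, hP0, hP⟩ := key y
    rw [hP, Polynomial.coeff_X_pow_mul', if_pos le_rfl, Nat.sub_self, hP0]

end Degeneracy

/-! ### Nonvanishing of configuration polynomials. -/

section Configuration

variable {K : Type*} [Field K] {E : Type*} [Fintype E]

/-- Linearly independent rows have a nonzero maximal minor. -/
theorem exists_det_submatrix_ne_zero {κ : Type*} [Fintype κ] [DecidableEq κ] (G : Matrix κ E K)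
    (hG : LinearIndependent K G.row) :
    ∃ f : κ → E, Function.Injective f ∧ (G.submatrix id f).det ≠ 0 := by
  -- A maximal independent set of columns; as row rank equals column rank, it has as many members as
  -- there are rows.
  obtain ⟨κ', a, ha, hspan, hli⟩ := exists_linearIndependent' K G.col
  have hcard : Module.finrank K (Submodule.span K (Set.range G.col)) = Fintype.card κ := by
    rw [← Matrix.rank_eq_finrank_span_cols, hG.rank_matrix]
  have := Finite.of_injective a ha
  have := Fintype.ofFinite κ'
  have hκ : Fintype.card κ = Fintype.card κ' := by
    rw [← hcard, ← hspan, finrank_span_eq_card hli]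
  let e := Fintype.equivOfCardEq hκ
  refine ⟨a ∘ e, ha.comp e.injective, ?_⟩
  have hcols : LinearIndependent K (G.submatrix id (a ∘ e)).col := hli.comp e e.injective
  rw [Matrix.linearIndependent_cols_iff_isUnit, Matrix.isUnit_iff_isUnit_det] at hcols
  exact hcols.ne_zero

theorem configFamily_apply (W : Submodule K (E → K)) (a : E → K) (v w : W) :
    (configFamily W a : W →ₗ[K] W →ₗ[K] K) v w = ∑ e, a e * ((v : E → K) e * (w : E → K) e) := by
  change (∑ e, a e • (LinearMap.proj e : (E → K) →ₗ[K] K).smulRight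
    (LinearMap.proj e : (E → K) →ₗ[K] K)) (v : E → K) (w : E → K) = _
  simp

/-- The configuration polynomial of a subspace is nonzero. -/
theorem exists_det_gram_configFamily_ne_zero (W : Submodule K (E → K)) {κ : Type*} [Fintype κ]
    [DecidableEq κ] {v : κ → W} (hv : LinearIndependent K v) :
    ∃ a : E → K, (gram (configFamily W a : W →ₗ[K] W →ₗ[K] K) v).det ≠ 0 := by
  classical
  let G : Matrix κ E K := Matrix.of fun k => (v k : E → K)
  have hG : LinearIndependent K G.row := hv.map' W.subtype (Submodule.ker_subtype W)
  obtain ⟨f, hf, hdet⟩ := exists_det_submatrix_ne_zero G hG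
  -- The indicator of the columns of the minor retains a single Cauchy–Binet term, the square of
  -- that minor.
  refine ⟨fun e => if e ∈ Finset.univ.image f then 1 else 0, ?_⟩
  have : gram (configFamily W (fun e => if e ∈ Finset.univ.image f then 1 else 0) :
      W →ₗ[K] W →ₗ[K] K) v = G.submatrix id f * (G.submatrix id f).transpose := by
    ext i j
    simp only [gram, Matrix.of_apply, configFamily_apply, ite_mul, one_mul, zero_mul,
      Finset.sum_ite_mem, Finset.univ_inter, Matrix.mul_apply, Matrix.submatrix_apply,
      Matrix.transpose_apply, id]
    rw [Finset.sum_image fun x _ y _ h => hf h]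
    rfl
  rw [this, Matrix.det_mul, Matrix.det_transpose]
  exact mul_ne_zero hdet hdet

end Configuration

/-! ### Tangent cones and multiplicities of degeneracy loci. -/

section DegeneracyTangentCone

variable {K : Type*} [Field K] [Infinite K] {W : Type*} [AddCommGroup W] [Module K W]
  {U : Type*} [AddCommGroup U] [Module K U] {σ ι κ : Type*} [Fintype σ] [Fintype ι]
  [DecidableEq ι] [Fintype κ] [DecidableEq κ]
  (c : Module.Basis σ K U) (β : Module.Basis ι K W) (φ : U →ₗ[K] SymForm K W)

/-- The vector `y₀` witnesses that the degree `dim N` part is nonzero, so it is the leading form of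
the determinant; otherwise the order could exceed `dim N`. -/
theorem leadingForms_degeneracyIdeal_iff {u y₀ : U} {N : Submodule K W}
    (hN : ∀ w, w ∈ N ↔ ∀ w', (φ u : W →ₗ[K] W →ₗ[K] K) w w' = 0) (γ : Module.Basis κ K N)
    (hy₀ : (gram (φ y₀ : W →ₗ[K] W →ₗ[K] K) fun k => (γ k : W)).det ≠ 0) (v : U) :
    (∀ g ∈ leadingForms c (degeneracyIdeal c β φ) u, evalAt c v g = 0) ↔
      (gram (φ v : W →ₗ[K] W →ₗ[K] K) fun k => (γ k : W)).det = 0 := by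
  obtain ⟨hlt, r, hr, h⟩ := exists_taylorAt_familyDet c β φ u hN γ
  have hne : homogeneousComponent (Fintype.card κ) (taylorAt c u (familyDet c β φ)) ≠ 0 := by
    intro h0
    have := h y₀
    rw [h0] at this
    exact mul_ne_zero hr hy₀ (this.symm.trans (map_zero _))
  refine (leadingForms_span_singleton_iff c (isHomogeneous_familyDet c β φ) hlt hne v).trans ?_
  rw [h, mul_eq_zero, or_iff_right hr]

theorem hasMultiplicity_degeneracyIdeal [CharZero K] {p : Projectivization K U} {y₀ : U}
    {N : Submodule K W} (hN : ∀ w, w ∈ N ↔ ∀ w', (φ p.rep : W →ₗ[K] W →ₗ[K] K) w w' = 0)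
    (γ : Module.Basis κ K N)
    (hy₀ : (gram (φ y₀ : W →ₗ[K] W →ₗ[K] K) fun k => (γ k : W)).det ≠ 0)
    (hκ : 1 ≤ Fintype.card κ) :
    HasMultiplicity c (degeneracyIdeal c β φ) p (Fintype.card κ) := by
  obtain ⟨hlt, r, hr, h⟩ := exists_taylorAt_familyDet c β φ p.rep hN γ
  refine hasMultiplicity_span_singleton c (isHomogeneous_familyDet c β φ) p hκ hlt fun h0 => ?_
  have := h y₀
  rw [h0] at this
  exact mul_ne_zero hr hy₀ (this.symm.trans (map_zero _))

/-- The projective tangent cone of the degeneracy locus consists of the forms that are degenerate on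
the kernel. -/
theorem mem_projTangentCone_degeneracyIdeal_iff {p q : Projectivization K U} {y₀ : U} {i : σ}
    (hi : c.repr p.rep i ≠ 0) {N : Submodule K W}
    (hN : ∀ w, w ∈ N ↔ ∀ w', (φ p.rep : W →ₗ[K] W →ₗ[K] K) w w' = 0) (γ : Module.Basis κ K N)
    (hy₀ : (gram (φ y₀ : W →ₗ[K] W →ₗ[K] K) fun k => (γ k : W)).det ≠ 0) :
    q ∈ projTangentCone c (degeneracyIdeal c β φ) p i ↔
      (gram (φ q.rep : W →ₗ[K] W →ₗ[K] K) fun k => (γ k : W)).det = 0 := by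
  have hN' : ∀ w, w ∈ N ↔ ∀ w', (φ (chartRep c p i) : W →ₗ[K] W →ₗ[K] K) w w' = 0 := by
    intro w
    rw [hN, chartRep, map_smul]
    refine forall_congr' fun w' => ?_
    change _ ↔ (c.repr p.rep i)⁻¹ * (φ p.rep : W →ₗ[K] W →ₗ[K] K) w w' = 0
    rw [mul_eq_zero, or_iff_right (inv_ne_zero hi)]
  refine (leadingForms_degeneracyIdeal_iff c β φ hN' γ hy₀ _).trans ?_
  -- The term involving `p` drops out because `φ p.rep` vanishes on its kernel, so the condition
  -- does not depend on the chart.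
  have hgram : gram (φ (c.repr p.rep i • q.rep - c.repr q.rep i • p.rep) : W →ₗ[K] W →ₗ[K] K)
      (fun k => (γ k : W)) =
      c.repr p.rep i • gram (φ q.rep : W →ₗ[K] W →ₗ[K] K) fun k => (γ k : W) := by
    ext k l
    have h0 := (hN _).mp (γ k).2 (γ l)
    rw [map_sub, map_smul, map_smul]
    change c.repr p.rep i * (φ q.rep : W →ₗ[K] W →ₗ[K] K) (γ k) (γ l) -
      c.repr q.rep i * (φ p.rep : W →ₗ[K] W →ₗ[K] K) (γ k) (γ l) = _
    rw [h0, mul_zero, sub_zero]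
    rfl
  rw [hgram, Matrix.det_smul, mul_eq_zero, or_iff_right (pow_ne_zero _ hi)]

end DegeneracyTangentCone

/-! ### Comparison of a degeneracy locus with its linear section. -/

section LinearSectionTangentCone

variable {K : Type*} [Field K] {W : Type*} [AddCommGroup W] [Module K W]
  {U U' : Type*} [AddCommGroup U] [Module K U] [AddCommGroup U'] [Module K U']

/-- A family of symmetric forms has a nondegenerate member on every finite-dimensional subspace. -/
def NondegenerateOnSubspaces (χ : U →ₗ[K] SymForm K W) : Prop :=
  ∀ (n : ℕ) (v : Fin n → W), LinearIndependent K v →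
    ∃ a, (gram (χ a : W →ₗ[K] W →ₗ[K] K) v).det ≠ 0

theorem det_gram_smul_eq_zero_iff {κ : Type*} [Fintype κ] [DecidableEq κ] {r : K} (hr : r ≠ 0)
    (B : W →ₗ[K] W →ₗ[K] K) (v : κ → W) :
    (gram (r • B) v).det = 0 ↔ (gram B v).det = 0 := by
  have : gram (r • B) v = r • gram B v := rfl
  rw [this, Matrix.det_smul, mul_eq_zero, or_iff_right (pow_ne_zero _ hr)]

theorem mem_ker_form_iff (B : W →ₗ[K] W →ₗ[K] K) (w : W) :
    w ∈ LinearMap.ker B ↔ ∀ w', B w w' = 0 :=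
  LinearMap.mem_ker.trans LinearMap.ext_iff

theorem mem_ker_form_iff_smul {r : K} (hr : r ≠ 0) (B : W →ₗ[K] W →ₗ[K] K) (w : W) :
    w ∈ LinearMap.ker B ↔ ∀ w', (r • B) w w' = 0 := by
  rw [mem_ker_form_iff]
  refine forall_congr' fun w' => ?_
  rw [LinearMap.smul_apply, LinearMap.smul_apply, smul_eq_zero, or_iff_right hr]

variable [Infinite K] {σ τ ι : Type*} [Fintype σ] [Fintype τ] [Fintype ι] [DecidableEq ι]
  (b : Module.Basis σ K U') (β : Module.Basis ι K W)
  {χ : U →ₗ[K] SymForm K W} {φ : U →ₗ[K] U'} {ψ : U' →ₗ[K] SymForm K W}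

theorem pullback_familyDet (c : Module.Basis τ K U) (hχ : ∀ a, χ a = ψ (φ a)) :
    pullback c b φ (familyDet b β ψ) = familyDet c β χ := by
  refine evalAt_ext c fun u => ?_
  rw [evalAt_pullback, evalAt_familyDet, evalAt_familyDet, hχ]

/-- The leading forms of a linear section of the degeneracy locus cut out the intersection of the
linear space with the zeros of the leading forms of the degeneracy locus. -/
theorem leadingForms_sup_iff (c : Module.Basis τ K U)
    (hχ : ∀ a, χ a = ψ (φ a)) (hnd : NondegenerateOnSubspaces χ)
    {u : U'} (hu : u ∈ LinearMap.range φ) (v : U') :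
    (∀ g ∈ leadingForms b (linearIdeal b (LinearMap.range φ) ⊔ degeneracyIdeal b β ψ) u,
        evalAt b v g = 0) ↔
      v ∈ LinearMap.range φ ∧ ∀ g ∈ leadingForms b (degeneracyIdeal b β ψ) u, evalAt b v g = 0 := by
  constructor
  · intro h
    have hle : degeneracyIdeal b β ψ ≤
        linearIdeal b (LinearMap.range φ) ⊔ degeneracyIdeal b β ψ :=
      fun _ hf => Ideal.mem_sup_right hf
    exact ⟨mem_of_forall_leadingForms b _ hu h,
      fun g hg => h g (leadingForms_mono b hle u hg)⟩
  · rintro ⟨hv, h⟩ g hg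
    obtain ⟨a, rfl⟩ := hu
    obtain ⟨v, rfl⟩ := hv
    have := Module.Basis.finiteDimensional_of_finite β
    let N := LinearMap.ker (χ a : W →ₗ[K] W →ₗ[K] K)
    have hN : ∀ w, w ∈ N ↔ ∀ w', (χ a : W →ₗ[K] W →ₗ[K] K) w w' = 0 := mem_ker_form_iff _
    have hN' : ∀ w, w ∈ N ↔ ∀ w', (ψ (φ a) : W →ₗ[K] W →ₗ[K] K) w w' = 0 := by
      rw [← hχ]
      exact hN
    let γ := Module.finBasis K N
    -- Nondegeneracy on `N` within the smaller family gives both loci the same order `dim N`.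
    obtain ⟨y₀, hy₀⟩ := hnd _ _ (γ.linearIndependent.map' N.subtype (Submodule.ker_subtype N))
    have hy₀' := hy₀
    rw [hχ] at hy₀'
    have hdet := (leadingForms_degeneracyIdeal_iff b β ψ hN' γ hy₀' _).mp h
    rw [← hχ] at hdet
    -- Evaluated on the parameter space, `g` becomes a leading form of the ideal of `familyDet c β
    -- χ`, hence vanishes wherever the form is degenerate on `N`.
    rw [← evalAt_pullback c]
    refine (leadingForms_degeneracyIdeal_iff c β χ hN γ hy₀ v).mpr hdet _ ?_
    have := pullback_mem_leadingForms c b φ (F := familyDet b β ψ) hg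
    rwa [pullback_familyDet b β c hχ] at this

theorem projTangentCone_sup (c : Module.Basis τ K U)
    (hχ : ∀ a, χ a = ψ (φ a)) (hnd : NondegenerateOnSubspaces χ)
    {p : Projectivization K U'} (hp : p.rep ∈ LinearMap.range φ) {i : σ}
    (hi : b.repr p.rep i ≠ 0) :
    projTangentCone b (linearIdeal b (LinearMap.range φ) ⊔ degeneracyIdeal b β ψ) p i =
      linearLocus (LinearMap.range φ) ∩ projTangentCone b (degeneracyIdeal b β ψ) p i := by
  ext q
  refine (leadingForms_sup_iff b β c hχ hnd (Submodule.smul_mem _ _ hp) _).trans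
    (and_congr_left fun _ => ?_)
  -- As `p` lies in the linear space and its `i`-th coordinate is nonzero, the homogenized argument
  -- lies there exactly when `q` does.
  rw [Submodule.sub_mem_iff_left _ (Submodule.smul_mem _ _ hp), Submodule.smul_mem_iff _ hi]
  rfl

theorem affineTangentCone_sup (c : Module.Basis τ K U)
    (hχ : ∀ a, χ a = ψ (φ a)) (hnd : NondegenerateOnSubspaces χ)
    {p : Projectivization K U'} (hp : p.rep ∈ LinearMap.range φ) (i : σ) :
    affineTangentCone b (linearIdeal b (LinearMap.range φ) ⊔ degeneracyIdeal b β ψ) p i =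
      (LinearMap.range φ : Set U') ∩ affineTangentCone b (degeneracyIdeal b β ψ) p i := by
  ext y
  have hu : chartRep b p i ∈ LinearMap.range φ := Submodule.smul_mem _ _ hp
  refine (and_congr_right fun _ => leadingForms_sup_iff b β c hχ hnd hu _).trans ?_
  rw [Submodule.sub_mem_iff_left _ hu]
  exact and_left_comm

/-- The common value is the dimension of the kernel `N`, which is the same for both forms since they
differ by the scalar `r`. -/
theorem exists_hasMultiplicity [CharZero K] (c : Module.Basis τ K U) (hχ : ∀ a, χ a = ψ (φ a))
    (hnd : NondegenerateOnSubspaces χ) {p : Projectivization K U} {p' : Projectivization K U'}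
    {r : K} (hr : r ≠ 0) (hp' : p'.rep = r • φ p.rep)
    (hp : p ∈ zeroLocus c (degeneracyIdeal c β χ)) :
    ∃ k : ℕ, HasMultiplicity c (degeneracyIdeal c β χ) p k ∧
      HasMultiplicity b (degeneracyIdeal b β ψ) p' k := by
  have := Module.Basis.finiteDimensional_of_finite β
  let N := LinearMap.ker (χ p.rep : W →ₗ[K] W →ₗ[K] K)
  have hN := mem_ker_form_iff (χ p.rep : W →ₗ[K] W →ₗ[K] K)
  have hN' : ∀ w, w ∈ N ↔ ∀ w', (ψ p'.rep : W →ₗ[K] W →ₗ[K] K) w w' = 0 := by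
    rw [hp', map_smul, ← hχ]
    exact mem_ker_form_iff_smul hr _
  let γ := Module.finBasis K N
  obtain ⟨y₀, hy₀⟩ := hnd _ _ (γ.linearIndependent.map' N.subtype (Submodule.ker_subtype N))
  have hy₀' := hy₀
  rw [hχ] at hy₀'
  -- If `N` were zero, the expansion would start with a nonzero constant term, the value of the
  -- determinant at `p`.
  have hcard : 1 ≤ Fintype.card (Fin (Module.finrank K N)) := by
    by_contra h0
    obtain ⟨-, s, hs, h⟩ := exists_taylorAt_familyDet c β χ p.rep hN γ
    have h1 := h y₀
    have hp0 : evalAt c p.rep (familyDet c β χ) = 0 :=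
      hp _ (Ideal.subset_span rfl) _ (isHomogeneous_familyDet c β χ)
    rw [show Fintype.card (Fin (Module.finrank K N)) = 0 by omega,
      homogeneousComponent_zero_taylorAt, hp0, C_0] at h1
    exact mul_ne_zero hs hy₀ (h1.symm.trans (map_zero _))
  exact ⟨_, hasMultiplicity_degeneracyIdeal c β χ hN γ hy₀ hcard,
    hasMultiplicity_degeneracyIdeal b β ψ hN' γ hy₀' hcard⟩

/-- Both conditions say that `χ q.rep` is degenerate on the kernel of `χ p.rep`; the scalars and the
charts play no role. -/
theorem mem_projTangentCone_iff_of_rep_eq (c : Module.Basis τ K U) (hχ : ∀ a, χ a = ψ (φ a))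
    (hnd : NondegenerateOnSubspaces χ) {p q : Projectivization K U}
    {p' q' : Projectivization K U'} {r s : K} (hr : r ≠ 0) (hp' : p'.rep = r • φ p.rep)
    (hs : s ≠ 0) (hq' : q'.rep = s • φ q.rep) {e : τ} (he : c.repr p.rep e ≠ 0) {i : σ}
    (hi : b.repr p'.rep i ≠ 0) :
    q ∈ projTangentCone c (degeneracyIdeal c β χ) p e ↔
      q' ∈ projTangentCone b (degeneracyIdeal b β ψ) p' i := by
  have := Module.Basis.finiteDimensional_of_finite β
  let N := LinearMap.ker (χ p.rep : W →ₗ[K] W →ₗ[K] K)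
  have hN := mem_ker_form_iff (χ p.rep : W →ₗ[K] W →ₗ[K] K)
  have hN' : ∀ w, w ∈ N ↔ ∀ w', (ψ p'.rep : W →ₗ[K] W →ₗ[K] K) w w' = 0 := by
    rw [hp', map_smul, ← hχ]
    exact mem_ker_form_iff_smul hr _
  let γ := Module.finBasis K N
  obtain ⟨y₀, hy₀⟩ := hnd _ _ (γ.linearIndependent.map' N.subtype (Submodule.ker_subtype N))
  have hy₀' := hy₀
  rw [hχ] at hy₀'
  rw [mem_projTangentCone_degeneracyIdeal_iff c β χ he hN γ hy₀,
    mem_projTangentCone_degeneracyIdeal_iff b β ψ hi hN' γ hy₀', hq', map_smul, ← hχ]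
  exact (det_gram_smul_eq_zero_iff hs _ _).symm

end LinearSectionTangentCone

/-! ### The map from the configuration's parameter space to symmetric forms. -/

section ConfigurationMap

variable {K : Type*} [Field K] {E : Type*} [Fintype E] (W : Submodule K (E → K))

theorem configFamily_ne_zero (x : {x : Projectivization K (E → K) // x ∉ vertex W}) :
    configFamily W x.1.rep ≠ 0 := x.2

/-- Representatives of projective points are arbitrary choices, so that of the image agrees with the
image of the representative only up to a scalar. -/
theorem exists_smul_configFamily_eq_piMap_rep
    (x : {x : Projectivization K (E → K) // x ∉ vertex W}) :
    ∃ r : K, r ≠ 0 ∧ (piMap W x).rep = r • configFamily W x.1.rep := by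
  obtain ⟨r, hr⟩ := Projectivization.exists_smul_eq_mk_rep K (V := SymForm K W)
    (configFamily W x.1.rep) (configFamily_ne_zero W x)
  exact ⟨r, r.ne_zero, hr.symm⟩

theorem configFamily_injective (hV : vertex W = ∅) : Function.Injective (configFamily W) := by
  refine (injective_iff_map_eq_zero (configFamily W)).mpr fun a ha => ?_
  by_contra h
  have hmem : Projectivization.mk K a h ∈ vertex W := by
    obtain ⟨r, hr⟩ := Projectivization.exists_smul_eq_mk_rep K a h
    change configFamily W (Projectivization.mk K a h).rep = 0
    rw [← hr, Units.smul_def, map_smul, ha, smul_zero]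
  rw [hV] at hmem
  exact hmem

theorem piMap_injective (hV : vertex W = ∅) : Function.Injective (piMap W) := by
  intro x y hxy
  obtain ⟨r, hr⟩ := (Projectivization.mk_eq_mk_iff' K (V := SymForm K W) _ _
    (configFamily_ne_zero W x) (configFamily_ne_zero W y)).mp hxy
  have hr' : configFamily W (r • y.1.rep) = configFamily W x.1.rep := by
    rw [map_smul]
    exact hr
  have := configFamily_injective W hV hr'
  refine Subtype.ext ?_
  rw [← x.1.mk_rep, ← y.1.mk_rep, Projectivization.mk_eq_mk_iff']
  exact ⟨r, this⟩

theorem exists_piMap_eq (hV : vertex W = ∅) {q : Projectivization K (SymForm K W)}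
    (hq : q.rep ∈ imageSpace W) : ∃ y, piMap W y = q := by
  obtain ⟨a, ha⟩ := hq
  have ha0 : a ≠ 0 := by
    rintro rfl
    exact q.rep_nonzero (by rw [← ha]; exact map_zero (configFamily W))
  let y : {x : Projectivization K (E → K) // x ∉ vertex W} :=
    ⟨Projectivization.mk K a ha0, by rw [hV]; exact Set.notMem_empty _⟩
  refine ⟨y, ?_⟩
  obtain ⟨r, hr⟩ := Projectivization.exists_smul_eq_mk_rep K a ha0
  rw [← q.mk_rep]
  refine (Projectivization.mk_eq_mk_iff' K (V := SymForm K W) _ _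
    (configFamily_ne_zero W y) q.rep_nonzero).mpr ⟨r, ?_⟩
  rw [← ha]
  exact (map_smul (configFamily W) (r : K) a).symm.trans (congrArg _ hr)

end ConfigurationMap

/-! ### Specialization to configuration hypersurfaces. -/

section ConfigurationTangentCone

variable {K : Type*} [Field K] {E : Type*} [Fintype E] (W : Submodule K (E → K))

theorem nondegenerateOnSubspaces_configFamily : NondegenerateOnSubspaces (configFamily W) :=
  fun _ _ hv => exists_det_gram_configFamily_ne_zero W hv

theorem piMap_rep_mem_imageSpace (x : {x : Projectivization K (E → K) // x ∉ vertex W}) :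
    (piMap W x).rep ∈ imageSpace W := by
  obtain ⟨r, -, h⟩ := exists_smul_configFamily_eq_piMap_rep W x
  rw [h]
  exact Submodule.smul_mem _ _ ⟨_, rfl⟩

variable [Infinite K] {ι : Type*} [Fintype ι] [DecidableEq ι] (β : Module.Basis ι K W)
  {σ : Type*} [Fintype σ] (b : Module.Basis σ K (SymForm K W))

theorem exists_hasMultiplicity_configIdeal [CharZero K]
    (x : {x : Projectivization K (E → K) // x ∉ vertex W})
    (hx : x.1 ∈ zeroLocus (Pi.basisFun K E) (configIdeal W β)) :
    ∃ k : ℕ, HasMultiplicity (Pi.basisFun K E) (configIdeal W β) x.1 k ∧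
      HasMultiplicity b (genericIdeal b β) (piMap W x) k := by
  obtain ⟨r, hr, h⟩ := exists_smul_configFamily_eq_piMap_rep W x
  -- The generic locus is the degeneracy locus of the identity family, so `ψ` is the identity and
  -- the parametrization `φ` is the configuration family itself.
  have hmult := exists_hasMultiplicity b β (Pi.basisFun K E) (U' := SymForm K W)
    (χ := configFamily W) (φ := configFamily W) (ψ := LinearMap.id) (fun _ => rfl)
    (nondegenerateOnSubspaces_configFamily W) (p := x.1) (p' := piMap W x) hr
  have hmult' := hmult h
  exact hmult' hx

theorem projTangentCone_sup_genericIdeal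
    (x : {x : Projectivization K (E → K) // x ∉ vertex W}) {i : σ}
    (hi : b.repr (piMap W x).rep i ≠ 0) :
    projTangentCone b (linearIdeal (U := SymForm K W) b (imageSpace W) ⊔ genericIdeal b β)
        (piMap W x) i =
      linearLocus (U := SymForm K W) (imageSpace W) ∩
        projTangentCone b (genericIdeal b β) (piMap W x) i := by
  have hproj := projTangentCone_sup b β (Pi.basisFun K E) (U' := SymForm K W)
    (χ := configFamily W) (φ := configFamily W) (ψ := LinearMap.id) (fun _ => rfl)
    (nondegenerateOnSubspaces_configFamily W) (p := piMap W x) (i := i)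
  have hproj' := hproj (piMap_rep_mem_imageSpace W x)
  exact hproj' hi

theorem affineTangentCone_sup_genericIdeal
    (x : {x : Projectivization K (E → K) // x ∉ vertex W}) (i : σ) :
    affineTangentCone b (linearIdeal (U := SymForm K W) b (imageSpace W) ⊔ genericIdeal b β)
        (piMap W x) i =
      (imageSpace W : Set (SymForm K W)) ∩
        affineTangentCone b (genericIdeal b β) (piMap W x) i := by
  have haff := affineTangentCone_sup b β (Pi.basisFun K E) (U' := SymForm K W)
    (χ := configFamily W) (φ := configFamily W) (ψ := LinearMap.id) (fun _ => rfl)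
    (nondegenerateOnSubspaces_configFamily W) (p := piMap W x)
  have haff' := haff (piMap_rep_mem_imageSpace W x)
  exact haff' i

theorem mem_projTangentCone_configIdeal_iff
    (x y : {x : Projectivization K (E → K) // x ∉ vertex W}) {e : E} (he : x.1.rep e ≠ 0)
    {i : σ} (hi : b.repr (piMap W x).rep i ≠ 0) :
    y.1 ∈ projTangentCone (Pi.basisFun K E) (configIdeal W β) x.1 e ↔
      piMap W y ∈ projTangentCone b (genericIdeal b β) (piMap W x) i := by
  obtain ⟨r, hr, h⟩ := exists_smul_configFamily_eq_piMap_rep W x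
  obtain ⟨s, hs, h'⟩ := exists_smul_configFamily_eq_piMap_rep W y
  have he' : (Pi.basisFun K E).repr x.1.rep e ≠ 0 := by
    rwa [Pi.basisFun_repr]
  have hmem := mem_projTangentCone_iff_of_rep_eq b β (Pi.basisFun K E) (U' := SymForm K W)
    (χ := configFamily W) (φ := configFamily W) (ψ := LinearMap.id) (fun _ => rfl)
    (nondegenerateOnSubspaces_configFamily W) (p := x.1) (p' := piMap W x) (q := y.1)
    (q' := piMap W y) (s := s) (e := e) (i := i) hr
  have hmem' := hmem h hs
  have hmem'' := hmem' h' he'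
  exact hmem'' hi

end ConfigurationTangentCone

end ConfigTC

open ConfigTC in
theorem corollaryC {K : Type*} [Field K] [IsAlgClosed K] [CharZero K]
    {E : Type*} [Fintype E] (W : Submodule K (E → K)) (hW : W ≠ ⊥)
    {ι : Type*} [Fintype ι] [DecidableEq ι] (β : Module.Basis ι K W)
    {σ : Type*} [Fintype σ] (b : Module.Basis σ K (SymForm K W)) :
    (∀ x : {x : Projectivization K (E → K) // x ∉ vertex W},
      x.1 ∈ zeroLocus (Pi.basisFun K E) (configIdeal W β) →
        (∃ k : ℕ, HasMultiplicity (Pi.basisFun K E) (configIdeal W β) x.1 k ∧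
          HasMultiplicity b (genericIdeal b β) (piMap W x) k) ∧
        ∀ i : σ, b.repr (piMap W x).rep i ≠ 0 →
          projTangentCone b (linearIdeal b (imageSpace W) ⊔ genericIdeal b β) (piMap W x) i =
              linearLocus (imageSpace W) ∩
                projTangentCone b (genericIdeal b β) (piMap W x) i ∧
          affineTangentCone b (linearIdeal b (imageSpace W) ⊔ genericIdeal b β) (piMap W x) i =
              (imageSpace W : Set (SymForm K W)) ∩
                affineTangentCone b (genericIdeal b β) (piMap W x) i) ∧
    (vertex W = ∅ →
      Function.Injective (configFamily W) ∧ Function.Injective (piMap W) ∧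
      ∀ x : {x : Projectivization K (E → K) // x ∉ vertex W},
        x.1 ∈ zeroLocus (Pi.basisFun K E) (configIdeal W β) →
        ∀ e : E, x.1.rep e ≠ 0 → ∀ i : σ, b.repr (piMap W x).rep i ≠ 0 →
          piMap W '' {y | y.1 ∈ projTangentCone (Pi.basisFun K E) (configIdeal W β) x.1 e} =
            linearLocus (imageSpace W) ∩
              projTangentCone b (genericIdeal b β) (piMap W x) i) := by
  refine ⟨fun x hx => ⟨exists_hasMultiplicity_configIdeal W β b x hx, fun i hi =>
      ⟨projTangentCone_sup_genericIdeal W β b x hi, affineTangentCone_sup_genericIdeal W β b x i⟩⟩,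
    fun hV => ⟨configFamily_injective W hV, piMap_injective W hV, fun x _ e he i hi => ?_⟩⟩
  ext q
  constructor
  · rintro ⟨y, hy, rfl⟩
    exact ⟨piMap_rep_mem_imageSpace W y,
      (mem_projTangentCone_configIdeal_iff W β b x y he hi).mp hy⟩
  · rintro ⟨hqL, hq⟩
    -- With empty vertex, every point of `L` is the image of a point of the source.
    obtain ⟨y, rfl⟩ := exists_piMap_eq W hV hqL
    exact ⟨y, (mem_projTangentCone_configIdeal_iff W β b x y he hi).mpr hq, rfl⟩
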